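/- Let $\zeta\ge 2$ and $d$ be natural numbers, let $\mathbb S^{\zeta-1}$ be the unit sphere of $\mathbb R^\zeta$ with its surface measure, and let $\mathbb{MS}=\mathbb S^{\zeta-1}\times\dots\times\mathbb S^{\zeta-1}$ ($d$ factors), with the product measure. Write $\mathbf x=(\mathbf x^{(1)},\dots,\mathbf x^{(d)})\in\mathbb{MS}$. Let $\boldsymbol k$ be a multi-dot product kernel on $\mathbb{MS}$ given by a power series with real coefficients $b_{\mathbf n}$, $\mathbf n\in\mathbb N^d$, $$\boldsymbol k(\mathbf x,\mathbf z)=\kappa\big(\langle \mathbf x^{(1)},\mathbf z^{(1)}\rangle,\dots,\langle \mathbf x^{(d)},\mathbf z^{(d)}\rangle\big),\qquad \kappa(\mathbf t)=\sum_{\mathbf n\ge 0} b_{\mathbf n}\,t_1^{n_1}\cdots t_d^{n_d},$$ where the series converges (absolutely) at every $\mathbf t\in[-1,1]^d$. Let $Q_k$ be the Gegenbauer polynomial of degree $k$, orthogonal on $[-1,1]$ with respect to the weight $(1-t^2)^{(\zeta-3)/2}$ and normalized by $Q_k(1)=1$, and put $$\lambda_k(t^n)=\int_{-1}^1 t^nQ_k(t)(1-t^2)^{\frac{\zeta-3}{2}}\,dt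 .$$ (i) If $n-k$ is even and non-negative, then $$\lambda_k(t^n)=\frac{n!}{(n-k)!\,2^{k}}\;\frac{\Gamma\left(\frac{\zeta-1}{2}\right)\Gamma\left(\frac{n-k+1}{2}\right)}{\Gamma\left(\frac{n+k+\zeta}{2}\right)},$$ and $\lambda_k(t^n)=0$ otherwise. (ii) For every $\mathbf k\in\mathbb N^d$ the series $$\lambda_{\mathbf k}:=\left|\mathbb S^{\zeta-2}\right|^d\sum_{\mathbf s\ge 0} b_{\mathbf k+2\mathbf s}\prod_{i=1}^d\lambda_{k_i}\big(t^{k_i+2s_i}\big)$$ converges absolutely, where $|\mathbb S^{\zeta-2}|$ is the surface area of the unit sphere of $\mathbb R^{\zeta-1}$, and $\lambda_{\mathbf k}$ is the eigenvalue of $\boldsymbol k$ at frequency $\mathbf k$: it is the unique real $\mu$ such that $\int_{\mathbb{MS}}\boldsymbol k(\mathbf x,\mathbf z)Y(\mathbf z)\,d\mathbf z=\mu\,Y(\mathbf x)$ for all $\mathbf x\in\mathbb{MS}$ and all products $Y(\mathbf x)=\prod_{i=1}^d Y_i(\mathbf x^{(i)})$ of spherical harmonics $Y_i$ of degree $k_i$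 on $\mathbb S^{\zeta-1}$. (iii) The real eigenvalues of the integral operator $f\mapsto\int_{\mathbb{MS}}\boldsymbol k(\cdot,\mathbf z)f(\mathbf z)\,d\mathbf z$ on $L^2(\mathbb{MS})$ are exactly the numbers $\lambda_{\mathbf k}$, $\mathbf k\in\mathbb N^d$. -/

import Mathlib

open MeasureTheory

noncomputable section

namespace MultiDot

/-- The unit sphere `S^{ζ-1}` of `ℝ^ζ`. -/
abbrev Pixel (ζ : ℕ) : Type := Metric.sphere (0 : EuclideanSpace ℝ (Fin ζ)) 1

/-- The multisphere `S^{ζ-1} × ⋯ × S^{ζ-1}` (`d` factors). -/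
abbrev Multisphere (ζ d : ℕ) : Type := Fin d → Pixel ζ

/-- The surface measure of the unit sphere of `ℝ^m`. -/
def surfaceMeasure (m : ℕ) : Measure (Pixel m) :=
  (volume : Measure (EuclideanSpace ℝ (Fin m))).toSphere

/-- The surface area of the unit sphere of `ℝ^m`, that is `|S^{m-1}|`. -/
def sphereArea (m : ℕ) : ℝ := (surfaceMeasure m).real Set.univ

/-- The (unnormalized) uniform measure of the multisphere: the product of the surface measures. -/
def multiMeasure (ζ d : ℕ) : Measure (Multisphere ζ d) :=
  Measure.pi fun _ => surfaceMeasure ζ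

/-- The vector `t ∈ [-1,1]^d` of dot products of corresponding pixels. -/
def pixelDots {ζ d : ℕ} (x z : Multisphere ζ d) : Fin d → ℝ :=
  fun i => inner ℝ (x i : EuclideanSpace ℝ (Fin ζ)) (z i : EuclideanSpace ℝ (Fin ζ))

/-- `K` is the multi-dot product kernel given by the function `κ` of the pixelwise dot products. -/
def IsMultiDotProduct {ζ d : ℕ} (K : Multisphere ζ d → Multisphere ζ d → ℝ)
    (κ : (Fin d → ℝ) → ℝ) : Prop :=
  ∀ x z, K x z = κ (pixelDots x z)

/-- `κ t = ∑_{n ≥ 0} b_n t^n` for every `t` in the hypercube `[-1,1]^d`. -/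
def HasPowerSeriesOnCube {d : ℕ} (κ : (Fin d → ℝ) → ℝ) (b : (Fin d → ℕ) → ℝ) : Prop :=
  ∀ t : Fin d → ℝ, (∀ i, t i ∈ Set.Icc (-1 : ℝ) 1) →
    HasSum (fun n : Fin d → ℕ => b n * ∏ i, t i ^ n i) (κ t)

/-- A spherical harmonic of frequency `k` on `S^{ζ-1}` (possibly zero): the restriction to the
sphere of a homogeneous polynomial of degree `k` whose Laplacian vanishes. -/
def IsSphericalHarmonic {ζ : ℕ} (k : ℕ) (Y : Pixel ζ → ℝ) : Prop :=
  ∃ p : MvPolynomial (Fin ζ) ℝ, p.IsHomogeneous k ∧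
    ∑ i, MvPolynomial.pderiv i (MvPolynomial.pderiv i p) = 0 ∧
    ∀ x : Pixel ζ, Y x = MvPolynomial.eval (fun i => (x : EuclideanSpace ℝ (Fin ζ)) i) p

/-- A product of spherical harmonics, of frequency vector `k`. -/
def IsSHProduct {ζ d : ℕ} (k : Fin d → ℕ) (Y : Multisphere ζ d → ℝ) : Prop :=
  ∃ y : Fin d → Pixel ζ → ℝ, (∀ i, IsSphericalHarmonic (k i) (y i)) ∧
    ∀ x, Y x = ∏ i, y i (x i)

/-- The integral operator with kernel `K`. -/
def kernelOp {ζ d : ℕ} (K : Multisphere ζ d → Multisphere ζ d → ℝ)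
    (f : Multisphere ζ d → ℝ) (x : Multisphere ζ d) : ℝ :=
  ∫ z, K x z * f z ∂(multiMeasure ζ d)

/-- `μ` is the eigenvalue of `K` at frequency `k`: every product of spherical harmonics of
frequency vector `k` satisfies the eigenvalue equation with `μ`. -/
def IsEigenvalueAt {ζ d : ℕ} (K : Multisphere ζ d → Multisphere ζ d → ℝ)
    (k : Fin d → ℕ) (μ : ℝ) : Prop :=
  ∀ Y : Multisphere ζ d → ℝ, IsSHProduct k Y → ∀ x, kernelOp K Y x = μ * Y x

/-- `μ` is an eigenvalue of the integral operator with kernel `K` on `L²` of the multisphere. -/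
def IsKernelEigenvalue {ζ d : ℕ} (K : Multisphere ζ d → Multisphere ζ d → ℝ) (μ : ℝ) : Prop :=
  ∃ f : Multisphere ζ d → ℝ, MemLp f 2 (multiMeasure ζ d) ∧ ¬ f =ᵐ[multiMeasure ζ d] 0 ∧
    ∀ᵐ x ∂(multiMeasure ζ d), kernelOp K f x = μ * f x

/-- The Gegenbauer polynomials `Q_k` of dimension `ζ ≥ 2`, orthogonal on `[-1,1]` with respect to
the weight `(1-t²)^{(ζ-3)/2}` and normalized by `Q_k(1) = 1`, through their three-term recurrence
`(k+ζ-1) Q_{k+2} = (2k+ζ) t Q_{k+1} - (k+1) Q_k`. -/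
def gegenbauer (ζ : ℕ) : ℕ → Polynomial ℝ
  | 0 => 1
  | 1 => Polynomial.X
  | k + 2 =>
      Polynomial.C ((2 * (k : ℝ) + ζ) / ((k : ℝ) + ζ - 1)) * Polynomial.X * gegenbauer ζ (k + 1)
        - Polynomial.C (((k : ℝ) + 1) / ((k : ℝ) + ζ - 1)) * gegenbauer ζ k

/-- `λ_k(t^n) = ∫_{-1}^1 t^n Q_k(t) (1-t²)^{(ζ-3)/2} dt`. -/
def monomialEigenvalue (ζ k n : ℕ) : ℝ :=
  ∫ t in (-1 : ℝ)..1,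
    t ^ n * (gegenbauer ζ k).eval t * (1 - t ^ 2) ^ (((ζ : ℝ) - 3) / 2)

/-- The term of index `s` of the series for the eigenvalue of frequency `k`. -/
def eigenTerm (ζ : ℕ) {d : ℕ} (b : (Fin d → ℕ) → ℝ) (k s : Fin d → ℕ) : ℝ :=
  b (fun i => k i + 2 * s i) * ∏ i, monomialEigenvalue ζ (k i) (k i + 2 * s i)

/-- `|S^{ζ-2}|^d ∑_{s ≥ 0} b_{k+2s} ∏_i λ_{k_i}(t^{k_i+2s_i})`. -/
def seriesEigenvalue (ζ : ℕ) {d : ℕ} (b : (Fin d → ℕ) → ℝ) (k : Fin d → ℕ) : ℝ :=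
  sphereArea (ζ - 1) ^ d * ∑' s : Fin d → ℕ, eigenTerm ζ b k s

end MultiDot

end

/-!
Gaussian integration by parts evaluates the moments of a power of a linear form against a harmonic
homogeneous polynomial `q` of degree `k`: for a unit vector `x`,
`∫ ⟨x, z⟩ⁿ q(z) exp (-|z|²) dz` is a multiple of `q(x)`, the factor being, up to powers of `2` and
`√π`, the integral of the `k`-th derivative of `tⁿ` against `exp (-t²)`. In polar coordinates the
radial part is a Gamma factor, so the spherical integrals are known as well, and the recurrence of
the Gegenbauer polynomials produces the same numbers: this is the Funk–Hecke formula for monomials.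
On the multisphere it applies factor by factor, and summing over the power series of the kernel
gives the eigenvalue on products of spherical harmonics.

Every polynomial restricts to the sphere as a sum of spherical harmonics, since the Laplacian of
`|x|² q` determines `q`. By Stone–Weierstrass, a square integrable function orthogonal to all
products of spherical harmonics then vanishes. As the kernel is symmetric, an eigenfunction of
eigenvalue `μ` that is not orthogonal to a product of frequency `k` forces `μ` to be the
eigenvalue at `k`.
-/

namespace MultiDot

open MvPolynomial

/-! ### Moments of the Gaussian weight -/

/-- The `n`-th moment of the weight `exp (-t²)` on the real line. -/
noncomputable def gaussianMoment (n : ℕ) : ℝ :=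
  ∫ t : ℝ, t ^ n * Real.exp (-t ^ 2)

theorem integrable_pow_mul_exp_neg_sq (n : ℕ) :
    Integrable fun t : ℝ => t ^ n * Real.exp (-t ^ 2) := by
  simpa using integrable_rpow_mul_exp_neg_mul_sq one_pos (neg_one_lt_zero.trans_le n.cast_nonneg)

theorem gaussianMoment_zero : gaussianMoment 0 = √Real.pi := by
  simpa [gaussianMoment] using integral_gaussian 1

theorem gaussianMoment_succ (n : ℕ) : gaussianMoment (n + 1) = n / 2 * gaussianMoment (n - 1) := by
  have hint := integrable_pow_mul_exp_neg_sq
  have hderiv (t : ℝ) : HasDerivAt (fun t : ℝ => t ^ n * Real.exp (-t ^ 2))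
      (n * (t ^ (n - 1) * Real.exp (-t ^ 2)) - 2 * (t ^ (n + 1) * Real.exp (-t ^ 2))) t := by
    convert! (hasDerivAt_pow n t).mul ((hasDerivAt_pow 2 t).fun_neg.exp) using 1
    push_cast
    ring
  have hzero := integral_eq_zero_of_hasDerivAt_of_integrable hderiv
    (((hint _).const_mul _).sub ((hint _).const_mul _)) (hint n)
  rw [integral_sub ((hint _).const_mul _) ((hint _).const_mul _), integral_const_mul,
    integral_const_mul] at hzero
  rw [gaussianMoment, gaussianMoment]
  linarith

theorem gaussianMoment_of_odd {n : ℕ} (hn : Odd n) : gaussianMoment n = 0 := by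
  have h := integral_neg_eq_self (fun t : ℝ => t ^ n * Real.exp (-t ^ 2)) volume
  simp only [hn.neg_pow, even_two.neg_pow, neg_mul, integral_neg] at h
  exact self_eq_neg.mp h.symm

theorem gaussianMoment_of_even {n : ℕ} (hn : Even n) :
    gaussianMoment n = Real.Gamma ((n + 1) / 2) := by
  have habs : gaussianMoment n = ∫ t : ℝ, |t| ^ n * Real.exp (-|t| ^ 2) := by
    simp only [gaussianMoment, hn.pow_abs, sq_abs]
  rw [habs, integral_comp_abs (f := fun t : ℝ => t ^ n * Real.exp (-t ^ 2))]
  have h := integral_rpow_mul_exp_neg_rpow two_pos (neg_one_lt_zero.trans_le n.cast_nonneg)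
  simp only [Real.rpow_natCast, Real.rpow_ofNat] at h
  rw [h]
  ring

/-- The integral of `(d/dt)ᵏ tⁿ`, equivalently of `tⁿ Hₖ(t)` with `Hₖ` the `k`-th (physicists')
Hermite polynomial, against `exp (-t²)`. The subtraction truncates only where `descFactorial`
vanishes. -/
noncomputable def hermiteMoment (k n : ℕ) : ℝ :=
  n.descFactorial k * gaussianMoment (n - k)

theorem hermiteMoment_zero_left (n : ℕ) : hermiteMoment 0 n = gaussianMoment n := by
  simp [hermiteMoment]

theorem hermiteMoment_succ (k n : ℕ) :
    hermiteMoment (k + 1) n = n * hermiteMoment k (n - 1) := by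
  cases n with
  | zero => simp [hermiteMoment]
  | succ n => simp only [hermiteMoment, Nat.succ_descFactorial_succ, Nat.add_sub_add_right,
      Nat.cast_mul, mul_assoc, Nat.add_sub_cancel]

theorem hermiteMoment_one_left (n : ℕ) : hermiteMoment 1 n = 2 * gaussianMoment (n + 1) := by
  rw [hermiteMoment_succ, hermiteMoment_zero_left, gaussianMoment_succ]
  ring

theorem hermiteMoment_add_two (k n : ℕ) :
    hermiteMoment (k + 2) n = 2 * ((n : ℝ) - k) * hermiteMoment k n := by
  rcases lt_trichotomy n k with hlt | rfl | hgt
  · simp [hermiteMoment, Nat.descFactorial_of_lt hlt]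
  · simp [hermiteMoment]
  · obtain ⟨j, rfl⟩ := Nat.exists_eq_add_of_lt hgt
    simp only [hermiteMoment, Nat.descFactorial_succ, show k + j + 1 - (k + 1) = j by lia,
      show k + j + 1 - k = j + 1 by lia, show k + j + 1 - (k + 2) = j - 1 by lia,
      gaussianMoment_succ]
    push_cast
    ring

theorem hermiteMoment_of_even {k n : ℕ} (hkn : k ≤ n) (heven : Even (n - k)) :
    hermiteMoment k n =
      n.factorial / (n - k).factorial * Real.Gamma (((n : ℝ) - k + 1) / 2) := by
  rw [hermiteMoment, gaussianMoment_of_even heven, Nat.cast_sub hkn,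
    ← Nat.factorial_mul_descFactorial hkn]
  push_cast
  field_simp

theorem hermiteMoment_eq_zero {k n : ℕ} (h : ¬(k ≤ n ∧ Even (n - k))) :
    hermiteMoment k n = 0 := by
  rcases lt_or_ge n k with hlt | hle
  · simp [hermiteMoment, Nat.descFactorial_of_lt hlt]
  · have hodd : Odd (n - k) := Nat.not_even_iff_odd.mp fun heven => h ⟨hle, heven⟩
    simp [hermiteMoment, gaussianMoment_of_odd hodd]

/-! ### Moments of the Gegenbauer weight -/

theorem ofReal_betaIntegrand {u v x : ℝ} (hx : x ∈ Set.uIcc (0 : ℝ) 1) :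
    (x : ℂ) ^ ((u : ℂ) - 1) * (1 - (x : ℂ)) ^ ((v : ℂ) - 1) =
      ((x ^ (u - 1) * (1 - x) ^ (v - 1) : ℝ) : ℂ) := by
  rw [Set.uIcc_of_le zero_le_one] at hx
  rw [Complex.ofReal_mul, Complex.ofReal_cpow hx.1, Complex.ofReal_cpow (sub_nonneg.mpr hx.2)]
  push_cast
  rfl

theorem intervalIntegrable_betaIntegrand {u v : ℝ} (hu : 0 < u) (hv : 0 < v) :
    IntervalIntegrable (fun x : ℝ => x ^ (u - 1) * (1 - x) ^ (v - 1)) volume 0 1 := by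
  have h := (Complex.betaIntegral_convergent (u := u) (v := v) (by simpa) (by simpa)).congr
    fun x hx => ofReal_betaIntegrand (Set.uIoc_subset_uIcc hx)
  rw [intervalIntegrable_iff] at h ⊢
  simpa using! h.re

theorem integral_betaIntegrand {u v : ℝ} (hu : 0 < u) (hv : 0 < v) :
    ∫ x in (0 : ℝ)..1, x ^ (u - 1) * (1 - x) ^ (v - 1) =
      Real.Gamma u * Real.Gamma v / Real.Gamma (u + v) := by
  have h := ProbabilityTheory.beta_eq_betaIntegralReal u v hu hv
  rw [ProbabilityTheory.beta] at h
  rw [h, Complex.betaIntegral,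
    intervalIntegral.integral_congr (fun x hx => ofReal_betaIntegrand hx),
    intervalIntegral.integral_ofReal, Complex.ofReal_re]

theorem image_sq_Ioo_zero_one : (fun t : ℝ => t ^ 2) '' Set.Ioo 0 1 = Set.Ioo 0 1 := by
  ext u
  constructor
  · rintro ⟨t, ⟨h0, h1⟩, rfl⟩
    exact ⟨by positivity, pow_lt_one₀ h0.le h1 two_ne_zero⟩
  · rintro ⟨h0, h1⟩
    exact ⟨√u, ⟨Real.sqrt_pos.mpr h0, by rwa [Real.sqrt_lt' one_pos, one_pow]⟩, Real.sq_sqrt h0.le⟩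

theorem injOn_sq_Ioo_zero_one : Set.InjOn (fun t : ℝ => t ^ 2) (Set.Ioo 0 1) :=
  fun _ ha _ hb h => (pow_left_inj₀ ha.1.le hb.1.le two_ne_zero).mp h

theorem abs_deriv_sq_smul_betaIntegrand (s : ℝ) (n : ℕ) {t : ℝ} (ht : t ∈ Set.Ioo (0 : ℝ) 1) :
    |2 * t| • ((t ^ 2) ^ (((n : ℝ) + 1) / 2 - 1) * (1 - t ^ 2) ^ (s - 1)) =
      2 * (t ^ n * (1 - t ^ 2) ^ (s - 1)) := by
  have hpow : t * (t ^ 2) ^ (((n : ℝ) + 1) / 2 - 1) = t ^ n := by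
    rw [← Real.rpow_natCast t n, ← Real.rpow_two, ← Real.rpow_mul ht.1.le]
    nth_rw 1 [← Real.rpow_one t]
    rw [← Real.rpow_add ht.1]
    ring_nf
  rw [abs_of_pos (mul_pos two_pos ht.1), smul_eq_mul, ← hpow]
  ring

section Weight

variable {s : ℝ}

theorem integrableOn_Ioo_pow_mul_weight (hs : 0 < s) (n : ℕ) :
    IntegrableOn (fun t : ℝ => t ^ n * (1 - t ^ 2) ^ (s - 1)) (Set.Ioo 0 1) := by
  have hn : (0 : ℝ) < (n + 1) / 2 := by positivity
  have hbeta := (intervalIntegrable_iff_integrableOn_Ioo_of_le zero_le_one).mp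
    (intervalIntegrable_betaIntegrand hn hs)
  rw [← image_sq_Ioo_zero_one, integrableOn_image_iff_integrableOn_abs_deriv_smul
    measurableSet_Ioo (fun t _ => (hasDerivAt_pow 2 t).hasDerivWithinAt)
    injOn_sq_Ioo_zero_one] at hbeta
  have hdouble : IntegrableOn (fun t : ℝ => 2 * (t ^ n * (1 - t ^ 2) ^ (s - 1))) (Set.Ioo 0 1) :=
    hbeta.congr_fun (fun t ht => by simpa using abs_deriv_sq_smul_betaIntegrand s n ht)
      measurableSet_Ioo
  exact (integrable_const_mul_iff (by norm_num) _).mp hdouble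

theorem two_mul_integral_zero_one_pow_mul_weight (hs : 0 < s) (n : ℕ) :
    2 * ∫ t in (0 : ℝ)..1, t ^ n * (1 - t ^ 2) ^ (s - 1) =
      Real.Gamma ((n + 1) / 2) * Real.Gamma s / Real.Gamma ((n + 1) / 2 + s) := by
  rw [← integral_betaIntegrand (by positivity) hs, ← intervalIntegral.integral_const_mul,
    intervalIntegral.integral_of_le zero_le_one, intervalIntegral.integral_of_le zero_le_one,
    integral_Ioc_eq_integral_Ioo, integral_Ioc_eq_integral_Ioo]
  conv_rhs => rw [← image_sq_Ioo_zero_one]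
  rw [integral_image_eq_integral_abs_deriv_smul measurableSet_Ioo
    (fun t _ => (hasDerivAt_pow 2 t).hasDerivWithinAt) injOn_sq_Ioo_zero_one]
  exact setIntegral_congr_fun measurableSet_Ioo fun t ht => by
    simpa using (abs_deriv_sq_smul_betaIntegrand s n ht).symm

theorem intervalIntegrable_weight (hs : 0 < s) :
    IntervalIntegrable (fun t : ℝ => (1 - t ^ 2) ^ (s - 1)) volume (-1) 1 := by
  have hright : IntervalIntegrable (fun t : ℝ => (1 - t ^ 2) ^ (s - 1)) volume 0 1 :=
    (intervalIntegrable_iff_integrableOn_Ioo_of_le zero_le_one).mpr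
      (by simpa using integrableOn_Ioo_pow_mul_weight hs 0)
  have hleft : IntervalIntegrable (fun t : ℝ => (1 - t ^ 2) ^ (s - 1)) volume (-1) 0 := by
    simpa using hright.symm.comp_sub_left 0
  exact hleft.trans hright

theorem intervalIntegrable_mul_weight (hs : 0 < s) {f : ℝ → ℝ} (hf : Continuous f) :
    IntervalIntegrable (fun t : ℝ => f t * (1 - t ^ 2) ^ (s - 1)) volume (-1) 1 :=
  (intervalIntegrable_weight hs).continuousOn_mul hf.continuousOn

theorem integral_pow_mul_weight (hs : 0 < s) (n : ℕ) :
    ∫ t in (-1 : ℝ)..1, t ^ n * (1 - t ^ 2) ^ (s - 1) =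
      Real.Gamma s * gaussianMoment n / Real.Gamma ((n + 1) / 2 + s) := by
  have hint := intervalIntegrable_mul_weight hs (f := fun t => t ^ n) (by fun_prop)
  have hreflect : ∫ t in (-1 : ℝ)..0, t ^ n * (1 - t ^ 2) ^ (s - 1) =
      (-1) ^ n * ∫ t in (0 : ℝ)..1, t ^ n * (1 - t ^ 2) ^ (s - 1) := by
    have h := intervalIntegral.integral_comp_neg (a := -1) (b := 0)
      fun t : ℝ => (-t) ^ n * (1 - t ^ 2) ^ (s - 1)
    simp only [neg_neg, even_two.neg_pow, neg_zero] at h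
    rw [h, ← intervalIntegral.integral_const_mul]
    exact intervalIntegral.integral_congr fun t _ => by
      simp only [neg_pow t n, mul_assoc]
  rw [← intervalIntegral.integral_add_adjacent_intervals (b := 0)
    (hint.mono_set (Set.uIcc_subset_uIcc (by simp) (by simp)))
    (hint.mono_set (Set.uIcc_subset_uIcc (by simp) (by simp))), hreflect]
  rcases n.even_or_odd with hn | hn
  · rw [hn.neg_one_pow, one_mul, ← two_mul, two_mul_integral_zero_one_pow_mul_weight hs,
      gaussianMoment_of_even hn, mul_comm (Real.Gamma s)]
  · rw [hn.neg_one_pow, gaussianMoment_of_odd hn]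
    simp

end Weight

/-! ### The eigenvalues of monomials -/

theorem monomialEigenvalue_zero (ζ n : ℕ) : monomialEigenvalue ζ 0 n =
    ∫ t in (-1 : ℝ)..1, t ^ n * (1 - t ^ 2) ^ (((ζ : ℝ) - 1) / 2 - 1) := by
  rw [monomialEigenvalue, show ((ζ : ℝ) - 1) / 2 - 1 = ((ζ : ℝ) - 3) / 2 by ring]
  simp [gegenbauer]

theorem monomialEigenvalue_one (ζ n : ℕ) :
    monomialEigenvalue ζ 1 n = monomialEigenvalue ζ 0 (n + 1) := by
  simp [monomialEigenvalue, gegenbauer, pow_succ]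

section MonomialEigenvalue

variable {ζ : ℕ} (hζ : 2 ≤ ζ)
include hζ

theorem half_pred_pos : 0 < ((ζ : ℝ) - 1) / 2 := by
  have : (2 : ℝ) ≤ ζ := by exact_mod_cast hζ
  linarith

theorem monomialEigenvalue_add_two (k n : ℕ) :
    monomialEigenvalue ζ (k + 2) n =
      (2 * (k : ℝ) + ζ) / ((k : ℝ) + ζ - 1) * monomialEigenvalue ζ (k + 1) (n + 1) -
        ((k : ℝ) + 1) / ((k : ℝ) + ζ - 1) * monomialEigenvalue ζ k n := by
  have hweight {f : ℝ → ℝ} (hf : Continuous f) (c : ℝ) :=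
    (intervalIntegrable_mul_weight (half_pred_pos hζ) hf).const_mul c
  have hexp : ((ζ : ℝ) - 3) / 2 = ((ζ : ℝ) - 1) / 2 - 1 := by ring
  simp only [monomialEigenvalue, hexp, ← intervalIntegral.integral_const_mul]
  rw [← intervalIntegral.integral_sub (hweight (by fun_prop) _) (hweight (by fun_prop) _)]
  refine intervalIntegral.integral_congr fun t _ => ?_
  simp only [gegenbauer, Polynomial.eval_sub, Polynomial.eval_mul, Polynomial.eval_C,
    Polynomial.eval_X]
  ring

theorem monomialEigenvalue_eq (k n : ℕ) :
    monomialEigenvalue ζ k n = Real.Gamma (((ζ : ℝ) - 1) / 2) / 2 ^ k * hermiteMoment k n /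
      Real.Gamma (((n : ℝ) + k + ζ) / 2) := by
  induction k using Nat.twoStepInduction generalizing n with
  | zero =>
    rw [monomialEigenvalue_zero, integral_pow_mul_weight (half_pred_pos hζ),
      hermiteMoment_zero_left]
    push_cast
    ring_nf
  | one =>
    rw [monomialEigenvalue_one, monomialEigenvalue_zero,
      integral_pow_mul_weight (half_pred_pos hζ), hermiteMoment_one_left]
    push_cast
    ring_nf
  | more k ih ih' =>
    have hk : (k : ℝ) + ζ - 1 ≠ 0 := by
      linarith [half_pred_pos hζ, k.cast_nonneg (α := ℝ)]
    have hX : 0 < ((n : ℝ) + k + ζ) / 2 := by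
      linarith [half_pred_pos hζ, k.cast_nonneg (α := ℝ), n.cast_nonneg (α := ℝ)]
    rw [monomialEigenvalue_add_two hζ, ih, ih', hermiteMoment_add_two, hermiteMoment_succ,
      Nat.add_sub_cancel]
    push_cast
    rw [show ((n : ℝ) + 1 + (k + 1) + ζ) / 2 = ((n : ℝ) + k + ζ) / 2 + 1 by ring,
      show ((n : ℝ) + (k + 2) + ζ) / 2 = ((n : ℝ) + k + ζ) / 2 + 1 by ring,
      Real.Gamma_add_one hX.ne']
    have hΓ := (Real.Gamma_pos_of_pos hX).ne'
    have hX' : (n : ℝ) + k + ζ ≠ 0 := by linarith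
    field_simp
    ring

theorem monomialEigenvalue_eq_zero {k n : ℕ} (h : ¬(k ≤ n ∧ Even (n - k))) :
    monomialEigenvalue ζ k n = 0 := by
  rw [monomialEigenvalue_eq hζ, hermiteMoment_eq_zero h, mul_zero, zero_div]

theorem monomialEigenvalue_eq_ite (k n : ℕ) :
    monomialEigenvalue ζ k n =
      if k ≤ n ∧ Even (n - k) then
        (n.factorial : ℝ) / (((n - k).factorial : ℝ) * 2 ^ k) *
          (Real.Gamma (((ζ : ℝ) - 1) / 2) * Real.Gamma (((n : ℝ) - k + 1) / 2) /
            Real.Gamma (((n : ℝ) + k + ζ) / 2))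
      else 0 := by
  split_ifs with h
  · rw [monomialEigenvalue_eq hζ, hermiteMoment_of_even h.1 h.2]
    ring
  · exact monomialEigenvalue_eq_zero hζ h

end MonomialEigenvalue

/-! ### Harmonic polynomials -/

section PolynomialCalculus

variable {ι R : Type*}

theorem pderiv_comm [CommSemiring R] (i j : ι) (q : MvPolynomial ι R) :
    pderiv i (pderiv j q) = pderiv j (pderiv i q) := by
  classical
  induction q using induction_on with
  | C a => simp
  | add p q hp hq => simp only [map_add, hp, hq]
  | mul_X p l hp =>
    have hconst (a b : ι) : pderiv a (pderiv b (X l : MvPolynomial ι R)) = 0 := by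
      rcases eq_or_ne l b with rfl | hl
      · rw [pderiv_X_self, pderiv_one]
      · rw [pderiv_X_of_ne hl, map_zero]
    simp only [pderiv_mul, map_add, hp, hconst]
    ring

variable [Fintype ι] [CommSemiring R]

/-- The Laplacian `∑ᵢ ∂ᵢ²` on polynomials. -/
noncomputable def laplacian : MvPolynomial ι R →ₗ[R] MvPolynomial ι R :=
  ∑ i, (pderiv i).toLinearMap ∘ₗ (pderiv i).toLinearMap

theorem laplacian_apply (q : MvPolynomial ι R) : laplacian q = ∑ i, pderiv i (pderiv i q) := by
  simp [laplacian]

/-- The derivative `∑ᵢ xᵢ ∂ᵢ` of polynomials in the direction `x`. -/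
noncomputable def dirDeriv (x : ι → R) : MvPolynomial ι R →ₗ[R] MvPolynomial ι R :=
  ∑ i, x i • (pderiv i).toLinearMap

theorem dirDeriv_apply (x : ι → R) (q : MvPolynomial ι R) :
    dirDeriv x q = ∑ i, x i • pderiv i q := by
  simp [dirDeriv]

theorem laplacian_dirDeriv (x : ι → R) (q : MvPolynomial ι R) :
    laplacian (dirDeriv x q) = dirDeriv x (laplacian q) := by
  simp only [laplacian_apply, dirDeriv_apply, map_sum, Derivation.map_smul]
  rw [Finset.sum_comm]
  refine Finset.sum_congr rfl fun i _ => Finset.sum_congr rfl fun j _ => ?_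
  rw [pderiv_comm i j q, pderiv_comm i j]

theorem eval_dirDeriv_self (x : ι → R) {q : MvPolynomial ι R} {k : ℕ} (hq : q.IsHomogeneous k) :
    eval x (dirDeriv x q) = k * eval x q := by
  simpa [dirDeriv_apply, smul_eval] using congrArg (eval x) hq.sum_X_mul_pderiv

/-- The linear form `∑ᵢ xᵢ Xᵢ`. -/
noncomputable def linearForm (x : ι → R) : MvPolynomial ι R :=
  ∑ i, x i • X i

theorem eval_linearForm (x z : ι → R) : eval z (linearForm x) = ∑ i, x i * z i := by
  simp [linearForm, smul_eval]

theorem isHomogeneous_linearForm (x : ι → R) : (linearForm x).IsHomogeneous 1 :=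
  IsHomogeneous.sum _ _ _ fun i _ => by
    simpa only [smul_eq_C_mul] using isHomogeneous_C_mul_X (x i) i

theorem pderiv_linearForm (x : ι → R) (i : ι) : pderiv i (linearForm x) = C (x i) := by
  classical
  simp [linearForm, pderiv_X, Pi.single_apply, smul_eq_C_mul]

theorem pderiv_linearForm_pow (x : ι → R) (i : ι) (n : ℕ) :
    pderiv i (linearForm x ^ n) = (n * x i) • linearForm x ^ (n - 1) := by
  rw [pderiv_pow, pderiv_linearForm, smul_eq_C_mul, C_mul, map_natCast]
  ring

variable (ι R) in
/-- The solid harmonics of degree `k`: the harmonic homogeneous polynomials of degree `k`. -/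
noncomputable def solidHarmonics (k : ℕ) : Submodule R (MvPolynomial ι R) :=
  homogeneousSubmodule ι R k ⊓ LinearMap.ker laplacian

theorem mem_solidHarmonics {k : ℕ} {q : MvPolynomial ι R} :
    q ∈ solidHarmonics ι R k ↔ q.IsHomogeneous k ∧ laplacian q = 0 := by
  simp [solidHarmonics]

theorem dirDeriv_mem_solidHarmonics (x : ι → R) {k : ℕ} {q : MvPolynomial ι R}
    (hq : q ∈ solidHarmonics ι R (k + 1)) : dirDeriv x q ∈ solidHarmonics ι R k := by
  rw [mem_solidHarmonics] at hq ⊢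
  refine ⟨?_, by rw [laplacian_dirDeriv, hq.2, map_zero]⟩
  rw [dirDeriv_apply]
  exact IsHomogeneous.sum _ _ _ fun i _ => by
    simpa only [smul_eq_C_mul, Nat.add_sub_cancel] using hq.1.pderiv.C_mul (x i)

end PolynomialCalculus

/-! ### Gaussian integrals of polynomials -/

section GaussianIntegral

variable {ι : Type*} [Fintype ι]

theorem eval_monomial_mul_gaussian (s : ι →₀ ℕ) (c : ℝ) (z : ι → ℝ) :
    eval z (monomial s c) * Real.exp (-∑ i, z i ^ 2) =
      c * ∏ i, (z i ^ s i * Real.exp (-z i ^ 2)) := by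
  rw [eval_monomial, Finset.prod_mul_distrib, ← Real.exp_sum,
    Finsupp.prod_fintype _ _ (by simp), Finset.sum_neg_distrib]
  ring

theorem integrable_eval_mul_gaussian (p : MvPolynomial ι ℝ) :
    Integrable fun z : ι → ℝ => eval z p * Real.exp (-∑ i, z i ^ 2) := by
  induction p using induction_on' with
  | monomial s c =>
    simp only [eval_monomial_mul_gaussian]
    exact (Integrable.fintype_prod fun i => integrable_pow_mul_exp_neg_sq _).const_mul _
  | add p q hp hq => simpa only [map_add, add_mul] using! hp.add hq

/-- The integral of a polynomial against the Gaussian weight `exp (-|z|²)`. -/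
noncomputable def gaussianIntegral : MvPolynomial ι ℝ →ₗ[ℝ] ℝ where
  toFun p := ∫ z : ι → ℝ, eval z p * Real.exp (-∑ i, z i ^ 2)
  map_add' p q := by
    simp only [map_add, add_mul]
    exact integral_add (integrable_eval_mul_gaussian p) (integrable_eval_mul_gaussian q)
  map_smul' c p := by
    simp only [smul_eval, mul_assoc, integral_const_mul, RingHom.id_apply, smul_eq_mul]

theorem gaussianIntegral_apply (p : MvPolynomial ι ℝ) :
    gaussianIntegral p = ∫ z : ι → ℝ, eval z p * Real.exp (-∑ i, z i ^ 2) := rfl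

theorem gaussianIntegral_monomial (s : ι →₀ ℕ) (c : ℝ) :
    gaussianIntegral (monomial s c) = c * ∏ i, gaussianMoment (s i) := by
  simp only [gaussianIntegral_apply, eval_monomial_mul_gaussian, gaussianMoment]
  rw [integral_const_mul,
    integral_fintype_prod_volume_eq_prod (fun i (t : ℝ) => t ^ s i * Real.exp (-t ^ 2))]

theorem gaussianIntegral_one :
    gaussianIntegral (1 : MvPolynomial ι ℝ) = √Real.pi ^ Fintype.card ι := by
  rw [← C_1, ← monomial_zero', gaussianIntegral_monomial]
  simp [gaussianMoment_zero]

theorem gaussianIntegral_X_mul (i : ι) (p : MvPolynomial ι ℝ) :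
    gaussianIntegral (X i * p) = 1 / 2 * gaussianIntegral (pderiv i p) := by
  classical
  induction p using induction_on' with
  | add p q hp hq => simp only [mul_add, map_add, hp, hq]
  | monomial s c =>
    have hoff (j : ι) (hj : j ∈ Finset.univ.erase i) :
        gaussianMoment ((Finsupp.single i 1 + s : ι →₀ ℕ) j) =
          gaussianMoment ((s - Finsupp.single i 1 : ι →₀ ℕ) j) := by
      simp [Finsupp.single_eq_of_ne (Finset.ne_of_mem_erase hj)]
    rw [pderiv_monomial, X, monomial_mul, gaussianIntegral_monomial, gaussianIntegral_monomial,
      ← Finset.mul_prod_erase _ _ (Finset.mem_univ i), Finset.prod_congr rfl hoff,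
      ← Finset.mul_prod_erase _ (fun j => gaussianMoment ((s - Finsupp.single i 1 : ι →₀ ℕ) j))
        (Finset.mem_univ i)]
    simp only [Finsupp.add_apply, Finsupp.single_eq_same, Finsupp.tsub_apply, add_comm 1 (s i),
      gaussianMoment_succ]
    ring

theorem gaussianIntegral_linearForm_pow_succ {x : ι → ℝ} (hx : ∑ i, x i ^ 2 = 1) (n : ℕ) :
    gaussianIntegral (linearForm x ^ (n + 1)) =
      n / 2 * gaussianIntegral (linearForm x ^ (n - 1)) :=
  calc gaussianIntegral (linearForm x ^ (n + 1))
    _ = ∑ i, x i * gaussianIntegral (X i * linearForm x ^ n) := by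
      simp only [← smul_eq_mul (_ : ℝ), ← map_smul, ← map_sum, ← smul_mul_assoc,
        ← Finset.sum_mul, pow_succ', linearForm]
    _ = ∑ i, x i ^ 2 * (n / 2 * gaussianIntegral (linearForm x ^ (n - 1))) := by
      refine Finset.sum_congr rfl fun i _ => ?_
      rw [gaussianIntegral_X_mul, pderiv_linearForm_pow, map_smul, smul_eq_mul]
      ring
    _ = n / 2 * gaussianIntegral (linearForm x ^ (n - 1)) := by
      rw [← Finset.sum_mul, hx, one_mul]

theorem gaussianIntegral_linearForm_pow {x : ι → ℝ} (hx : ∑ i, x i ^ 2 = 1) (n : ℕ) :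
    √Real.pi * gaussianIntegral (linearForm x ^ n) =
      gaussianMoment n * √Real.pi ^ Fintype.card ι := by
  induction n using Nat.twoStepInduction with
  | zero => rw [pow_zero, gaussianIntegral_one, gaussianMoment_zero]
  | one =>
    rw [← zero_add 1, gaussianIntegral_linearForm_pow_succ hx, gaussianMoment_succ]
    simp
  | more n ih _ =>
    rw [gaussianIntegral_linearForm_pow_succ hx, gaussianMoment_succ, Nat.add_sub_cancel,
      mul_left_comm, ih, mul_assoc]

theorem natCast_mul_gaussianIntegral_linearForm_pow_mul (x : ι → ℝ) (n : ℕ) {k : ℕ}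
    {q : MvPolynomial ι ℝ} (hq : q ∈ solidHarmonics ι ℝ k) :
    k * gaussianIntegral (linearForm x ^ n * q) =
      n / 2 * gaussianIntegral (linearForm x ^ (n - 1) * dirDeriv x q) := by
  have hleibniz (i : ι) : pderiv i (linearForm x ^ n * pderiv i q) =
      (n : ℝ) • (linearForm x ^ (n - 1) * x i • pderiv i q) +
        linearForm x ^ n * pderiv i (pderiv i q) := by
    rw [pderiv_mul, pderiv_linearForm_pow]
    simp only [smul_mul_assoc, mul_smul_comm, mul_smul]
  rw [mem_solidHarmonics] at hq
  calc k * gaussianIntegral (linearForm x ^ n * q)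
    _ = gaussianIntegral (linearForm x ^ n * ∑ i, X i * pderiv i q) := by
      rw [hq.1.sum_X_mul_pderiv, mul_smul_comm, map_nsmul, nsmul_eq_mul]
    _ = 1 / 2 * gaussianIntegral (∑ i, pderiv i (linearForm x ^ n * pderiv i q)) := by
      simp only [Finset.mul_sum, map_sum, mul_left_comm _ (X _), gaussianIntegral_X_mul]
    _ = 1 / 2 * gaussianIntegral ((n : ℝ) • (linearForm x ^ (n - 1) * dirDeriv x q) +
          linearForm x ^ n * laplacian q) := by
      simp only [hleibniz, Finset.sum_add_distrib, ← Finset.smul_sum, ← Finset.mul_sum,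
        dirDeriv_apply, laplacian_apply]
    _ = n / 2 * gaussianIntegral (linearForm x ^ (n - 1) * dirDeriv x q) := by
      rw [hq.2, mul_zero, add_zero, map_smul, smul_eq_mul]
      ring

theorem gaussianIntegral_linearForm_pow_mul {x : ι → ℝ} (hx : ∑ i, x i ^ 2 = 1) (n : ℕ) {k : ℕ}
    {q : MvPolynomial ι ℝ} (hq : q ∈ solidHarmonics ι ℝ k) :
    2 ^ k * √Real.pi * gaussianIntegral (linearForm x ^ n * q) =
      hermiteMoment k n * √Real.pi ^ Fintype.card ι * eval x q := by
  induction k generalizing n q with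
  | zero =>
    obtain ⟨c, rfl⟩ : ∃ c, q = C c :=
      ⟨_, totalDegree_eq_zero_iff_eq_C.mp
        ((totalDegree_zero_iff_isHomogeneous _).mpr (mem_solidHarmonics.mp hq).1)⟩
    rw [mul_comm _ (C c), ← smul_eq_C_mul, map_smul, smul_eq_mul, mul_left_comm, pow_zero, one_mul,
      gaussianIntegral_linearForm_pow hx, hermiteMoment_zero_left, eval_C]
    ring
  | succ k ih =>
    have hstep := natCast_mul_gaussianIntegral_linearForm_pow_mul x n hq
    have hD := ih (n - 1) (dirDeriv_mem_solidHarmonics x hq)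
    rw [eval_dirDeriv_self x (mem_solidHarmonics.mp hq).1] at hD
    rw [hermiteMoment_succ, pow_succ]
    refine mul_left_cancel₀ (Nat.cast_ne_zero.mpr k.succ_ne_zero) ?_
    linear_combination (2 ^ (k + 1) * √Real.pi) * hstep + n * hD

end GaussianIntegral

/-! ### The Funk–Hecke formula for monomials -/

section Polar

open Set

theorem integral_volumeIoiPow (n : ℕ) (g : ℝ → ℝ) :
    ∫ r : Ioi (0 : ℝ), g r ∂.volumeIoiPow n = ∫ r in Ioi (0 : ℝ), r ^ n * g r := by
  have hmeas : Measurable fun r : Ioi (0 : ℝ) => Real.toNNReal ((r : ℝ) ^ n) :=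
    (measurable_subtype_coe.pow_const n).real_toNNReal
  simp only [Measure.volumeIoiPow, ENNReal.ofReal]
  rw [integral_withDensity_eq_integral_smul hmeas,
    integral_subtype_comap measurableSet_Ioi fun r => Real.toNNReal (r ^ n) • g r]
  refine setIntegral_congr_fun measurableSet_Ioi fun r hr => ?_
  simp only [NNReal.smul_def, Real.coe_toNNReal _ (pow_nonneg (mem_Ioi.mp hr).le n), smul_eq_mul]

theorem integral_eq_integral_toSphere_mul {E : Type*} [NormedAddCommGroup E] [NormedSpace ℝ E]
    [MeasurableSpace E] [BorelSpace E] [FiniteDimensional ℝ E] [Nontrivial E]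
    (μ : Measure E) [μ.IsAddHaarMeasure] {F : E → ℝ} {f : Metric.sphere (0 : E) 1 → ℝ} {g : ℝ → ℝ}
    (hF : ∀ (ω : Metric.sphere (0 : E) 1) (r : ℝ), 0 < r → F (r • (ω : E)) = f ω * g r) :
    ∫ z, F z ∂μ = (∫ ω, f ω ∂μ.toSphere) *
      ∫ r in Ioi (0 : ℝ), r ^ (Module.finrank ℝ E - 1) * g r :=
  calc ∫ z, F z ∂μ
    _ = ∫ z : ({0}ᶜ : Set E), F z ∂(μ.comap (↑)) := by
      rw [integral_subtype_comap (measurableSet_singleton _).compl F, restrict_compl_singleton]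
    _ = ∫ y, F ((y.2 : ℝ) • (y.1 : E))
          ∂μ.toSphere.prod (.volumeIoiPow (Module.finrank ℝ E - 1)) := by
      rw [← μ.measurePreserving_homeomorphUnitSphereProd.integral_comp
        (Homeomorph.measurableEmbedding _)]
      refine integral_congr_ae (.of_forall fun z => ?_)
      have hz : ‖(z : E)‖ ≠ 0 := norm_ne_zero_iff.mpr z.2
      simp [smul_smul, hz]
    _ = ∫ y, f y.1 * g (y.2 : ℝ) ∂μ.toSphere.prod (.volumeIoiPow (Module.finrank ℝ E - 1)) :=
      integral_congr_ae (.of_forall fun y => hF y.1 y.2 y.2.2)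
    _ = (∫ ω, f ω ∂μ.toSphere) *
          ∫ r in Ioi (0 : ℝ), r ^ (Module.finrank ℝ E - 1) * g r := by
      rw [integral_prod_mul f (fun r : Ioi (0 : ℝ) => g r), integral_volumeIoiPow]

end Polar

theorem eval_smul_of_isHomogeneous {ι R : Type*} [CommSemiring R] {p : MvPolynomial ι R} {k : ℕ}
    (hp : p.IsHomogeneous k) (r : R) (x : ι → R) : eval (r • x) p = r ^ k * eval x p := by
  rw [eval_eq, eval_eq, Finset.mul_sum]
  refine Finset.sum_congr rfl fun s hs => ?_
  simp only [Pi.smul_apply, smul_eq_mul, mul_pow, Finset.prod_mul_distrib,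
    Finset.prod_pow_eq_pow_sum, hp.degree_eq_sum_deg_support hs]
  ring

/-- The restriction of a polynomial to the unit sphere. -/
noncomputable def sphereRestrict (ζ : ℕ) : MvPolynomial (Fin ζ) ℝ →ₐ[ℝ] C(Pixel ζ, ℝ) :=
  aeval fun i => ⟨fun x => (x : EuclideanSpace ℝ (Fin ζ)) i, by fun_prop⟩

section Sphere

variable {ζ : ℕ}

theorem sphereRestrict_apply (p : MvPolynomial (Fin ζ) ℝ) (x : Pixel ζ) :
    sphereRestrict ζ p x = eval (x : EuclideanSpace ℝ (Fin ζ)).ofLp p := by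
  induction p using induction_on with
  | C a => simp [sphereRestrict]
  | add p q hp hq => simp [hp, hq]
  | mul_X p i hp =>
    rw [map_mul, map_mul, ContinuousMap.mul_apply, hp, eval_X]
    simp [sphereRestrict]

theorem isSphericalHarmonic_iff {k : ℕ} {Y : Pixel ζ → ℝ} :
    IsSphericalHarmonic k Y ↔ ∃ q ∈ solidHarmonics (Fin ζ) ℝ k, Y = sphereRestrict ζ q := by
  simp only [IsSphericalHarmonic, mem_solidHarmonics, laplacian_apply, funext_iff,
    sphereRestrict_apply, and_assoc]

theorem sum_sq_eq_one (x : Pixel ζ) : ∑ i, (x : EuclideanSpace ℝ (Fin ζ)) i ^ 2 = 1 := by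
  rw [← EuclideanSpace.real_norm_sq_eq, norm_eq_of_mem_sphere, one_pow]

theorem integral_Ioi_pow_mul_exp_neg_sq (n : ℕ) :
    ∫ r in Set.Ioi (0 : ℝ), r ^ n * Real.exp (-r ^ 2) = Real.Gamma ((n + 1) / 2) / 2 := by
  have h := integral_rpow_mul_exp_neg_rpow (p := 2) (q := n) two_pos
    (by linarith [n.cast_nonneg (α := ℝ)])
  simp only [Real.rpow_natCast, Real.rpow_two] at h
  rw [h]
  ring

theorem gaussianIntegral_eq_integral_sphereRestrict_mul (hζ : ζ ≠ 0)
    {p : MvPolynomial (Fin ζ) ℝ} {N : ℕ} (hp : p.IsHomogeneous N) :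
    gaussianIntegral p =
      (∫ ω, sphereRestrict ζ p ω ∂surfaceMeasure ζ) * (Real.Gamma ((N + ζ) / 2) / 2) := by
  have : Nonempty (Fin ζ) := ⟨⟨0, Nat.pos_of_ne_zero hζ⟩⟩
  rw [gaussianIntegral_apply, ← (PiLp.volume_preserving_ofLp (Fin ζ)).integral_comp
      (MeasurableEquiv.toLp 2 (Fin ζ → ℝ)).symm.measurableEmbedding,
    integral_eq_integral_toSphere_mul (volume : Measure (EuclideanSpace ℝ (Fin ζ)))
      (f := sphereRestrict ζ p) (g := fun r => r ^ N * Real.exp (-r ^ 2)) fun ω r _ => ?_]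
  · simp only [finrank_euclideanSpace_fin, ← mul_assoc, ← pow_add,
      integral_Ioi_pow_mul_exp_neg_sq, surfaceMeasure]
    rw [Nat.cast_add, Nat.cast_sub (Nat.one_le_iff_ne_zero.mpr hζ), Nat.cast_one]
    ring_nf
  · simp only [WithLp.ofLp_smul, eval_smul_of_isHomogeneous hp, sphereRestrict_apply,
      Pi.smul_apply, smul_eq_mul, mul_pow, ← Finset.mul_sum, sum_sq_eq_one]
    ring_nf

theorem sphereArea_eq {m : ℕ} (hm : m ≠ 0) :
    sphereArea m = 2 * √Real.pi ^ m / Real.Gamma (m / 2) := by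
  have : Nonempty (Fin m) := ⟨⟨0, Nat.pos_of_ne_zero hm⟩⟩
  have hm' : (0 : ℝ) < m / 2 := by positivity
  have := Real.Gamma_pos_of_pos hm'
  rw [sphereArea, surfaceMeasure, Measure.toSphere_real_apply_univ, measureReal_def,
    EuclideanSpace.volume_ball, finrank_euclideanSpace_fin, Fintype.card_fin, ENNReal.ofReal_one,
    one_pow, one_mul, Real.Gamma_add_one hm'.ne', ENNReal.toReal_ofReal (by positivity)]
  field_simp

theorem sphereArea_pos {m : ℕ} (hm : m ≠ 0) : 0 < sphereArea m := by
  have := Real.Gamma_pos_of_pos (show (0 : ℝ) < (m : ℝ) / 2 by positivity)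
  rw [sphereArea_eq hm]
  positivity

theorem sphereRestrict_linearForm (x z : Pixel ζ) :
    sphereRestrict ζ (linearForm (x : EuclideanSpace ℝ (Fin ζ)).ofLp) z =
      inner ℝ (x : EuclideanSpace ℝ (Fin ζ)) z := by
  simp [sphereRestrict_apply, eval_linearForm, PiLp.inner_apply, mul_comm]

theorem integral_inner_pow_mul_sphericalHarmonic (hζ : 2 ≤ ζ) {k : ℕ} {Y : Pixel ζ → ℝ}
    (hY : IsSphericalHarmonic k Y) (n : ℕ) (x : Pixel ζ) :
    ∫ z : Pixel ζ, inner ℝ (x : EuclideanSpace ℝ (Fin ζ)) (z : EuclideanSpace ℝ (Fin ζ)) ^ n * Y z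
      ∂surfaceMeasure ζ = sphereArea (ζ - 1) * monomialEigenvalue ζ k n * Y x := by
  obtain ⟨q, hq, rfl⟩ := isSphericalHarmonic_iff.mp hY
  have hgauss := gaussianIntegral_linearForm_pow_mul (sum_sq_eq_one x) n hq
  have hpolar := gaussianIntegral_eq_integral_sphereRestrict_mul (by lia : ζ ≠ 0)
    (((isHomogeneous_linearForm (x : EuclideanSpace ℝ (Fin ζ)).ofLp).pow n).mul
      (mem_solidHarmonics.mp hq).1)
  simp only [map_mul, map_pow, ContinuousMap.mul_apply, ContinuousMap.pow_apply,
    sphereRestrict_linearForm, one_mul, Nat.cast_add] at hpolar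
  have hΓ := (Real.Gamma_pos_of_pos (show 0 < ((n : ℝ) + k + ζ) / 2 by positivity)).ne'
  have hΓ' := (Real.Gamma_pos_of_pos (half_pred_pos hζ)).ne'
  obtain ⟨m, rfl⟩ : ∃ m, ζ = m + 1 := ⟨ζ - 1, by lia⟩
  rw [hpolar, Fintype.card_fin, pow_succ, ← sphereRestrict_apply] at hgauss
  rw [monomialEigenvalue_eq hζ, Nat.add_sub_cancel, sphereArea_eq (by lia)]
  simp only [Nat.cast_add, Nat.cast_one, add_sub_cancel_right] at hgauss hΓ hΓ' ⊢
  have hπ : √Real.pi ≠ 0 := by positivity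
  field_simp
  refine mul_left_cancel₀ hπ ?_
  linear_combination 2 * hgauss

end Sphere

/-! ### Harmonic decomposition of polynomials -/

section HarmonicDecomposition

variable {ι R : Type*} [Fintype ι]

variable (ι R) in
/-- The square of the Euclidean norm, as a polynomial. -/
noncomputable def normSqPoly [CommSemiring R] : MvPolynomial ι R := ∑ i, X i ^ 2

theorem isHomogeneous_normSqPoly_mul [CommSemiring R] {q : MvPolynomial ι R} {k : ℕ}
    (hq : q.IsHomogeneous k) : (normSqPoly ι R * q).IsHomogeneous (k + 2) := by
  rw [add_comm]
  exact (IsHomogeneous.sum _ _ _ fun i _ => isHomogeneous_X_pow i 2).mul hq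

theorem pderiv_normSqPoly [CommSemiring R] (i : ι) : pderiv i (normSqPoly ι R) = 2 * X i := by
  classical
  simp [normSqPoly, Derivation.leibniz_pow, pderiv_X, Pi.single_apply]

theorem laplacian_normSqPoly_mul [CommSemiring R] {v : MvPolynomial ι R} {k : ℕ}
    (hv : v.IsHomogeneous k) :
    laplacian (normSqPoly ι R * v) =
      (2 * (Fintype.card ι : R) + 4 * k) • v + normSqPoly ι R * laplacian v := by
  have hpderiv (i : ι) : pderiv i (pderiv i (normSqPoly ι R * v)) =
      2 * v + 4 * (X i * pderiv i v) + normSqPoly ι R * pderiv i (pderiv i v) := by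
    have htwo : pderiv i (2 : MvPolynomial ι R) = 0 := pderiv_C (a := 2)
    simp only [pderiv_mul, pderiv_normSqPoly, map_add, pderiv_X_self, htwo]
    ring
  simp only [laplacian_apply, hpderiv, Finset.sum_add_distrib, ← Finset.mul_sum,
    hv.sum_X_mul_pderiv, Finset.sum_const, Finset.card_univ]
  simp only [nsmul_eq_mul, smul_eq_C_mul, map_add, map_mul, map_natCast, map_ofNat]
  ring

theorem isHomogeneous_laplacian [CommSemiring R] {q : MvPolynomial ι R} {k : ℕ}
    (hq : q.IsHomogeneous (k + 2)) : (laplacian q).IsHomogeneous k := by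
  rw [laplacian_apply]
  exact IsHomogeneous.sum _ _ _ fun i _ => hq.pderiv.pderiv

theorem laplacian_eq_zero_of_lt_two [CommSemiring R] {q : MvPolynomial ι R} {k : ℕ}
    (hq : q.IsHomogeneous k) (hk : k < 2) : laplacian q = 0 := by
  rw [laplacian_apply]
  refine Finset.sum_eq_zero fun i _ => ?_
  have hconst : (pderiv i q).IsHomogeneous 0 := by
    simpa only [Nat.sub_eq_zero_of_le (Nat.le_of_lt_succ hk)] using hq.pderiv (i := i)
  rw [← totalDegree_zero_iff_isHomogeneous, totalDegree_eq_zero_iff_eq_C] at hconst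
  rw [hconst, pderiv_C]

variable [Field R] [LinearOrder R] [IsStrictOrderedRing R]

theorem exists_smul_add_normSqPoly_mul_laplacian_eq {c : R} (hc : 0 < c) {k : ℕ}
    {q : MvPolynomial ι R} (hq : q.IsHomogeneous k) :
    ∃ u : MvPolynomial ι R, u.IsHomogeneous k ∧ c • u + normSqPoly ι R * laplacian u = q := by
  have hsmul {k : ℕ} (a : R) {p : MvPolynomial ι R} (hp : p.IsHomogeneous k) :
      (a • p).IsHomogeneous k := (homogeneousSubmodule ι R k).smul_mem a hp
  induction k using Nat.strong_induction_on generalizing c q with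
  | _ k ih =>
    rcases lt_or_ge k 2 with hk | hk
    · refine ⟨c⁻¹ • q, hsmul _ hq, ?_⟩
      rw [map_smul, laplacian_eq_zero_of_lt_two hq hk, smul_inv_smul₀ hc.ne', smul_zero, mul_zero,
        add_zero]
    obtain ⟨k, rfl⟩ := Nat.exists_eq_add_of_le' hk
    -- Applying `Δ` to the equation for `u` gives one of the same form for `v = Δu`.
    obtain ⟨v, hv, hvq⟩ := ih k (by lia) (add_pos_of_pos_of_nonneg hc
      (by positivity : 0 ≤ 2 * (Fintype.card ι : R) + 4 * k)) (isHomogeneous_laplacian hq)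
    refine ⟨c⁻¹ • (q - normSqPoly ι R * v),
      hsmul _ (hq.sub (isHomogeneous_normSqPoly_mul hv)), ?_⟩
    have hlap : laplacian (q - normSqPoly ι R * v) = c • v := by
      rw [map_sub, laplacian_normSqPoly_mul hv, ← hvq, add_smul]
      abel
    rw [map_smul, hlap, smul_inv_smul₀ hc.ne', inv_smul_smul₀ hc.ne', sub_add_cancel]

theorem exists_eq_solidHarmonic_add_normSqPoly_mul [Nonempty ι] {k : ℕ} {p : MvPolynomial ι R}
    (hp : p.IsHomogeneous k) :
    ∃ h ∈ solidHarmonics ι R k, ∃ q : MvPolynomial ι R,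
      q.IsHomogeneous (k - 2) ∧ p = h + normSqPoly ι R * q := by
  rcases lt_or_ge k 2 with hk | hk
  · exact ⟨p, mem_solidHarmonics.mpr ⟨hp, laplacian_eq_zero_of_lt_two hp hk⟩, 0,
      isHomogeneous_zero _ _ _, by rw [mul_zero, add_zero]⟩
  obtain ⟨k, rfl⟩ := Nat.exists_eq_add_of_le' hk
  obtain ⟨q, hq, hpq⟩ := exists_smul_add_normSqPoly_mul_laplacian_eq
    (by positivity : 0 < 2 * (Fintype.card ι : R) + 4 * k) (isHomogeneous_laplacian hp)
  refine ⟨p - normSqPoly ι R * q, mem_solidHarmonics.mpr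
    ⟨hp.sub (isHomogeneous_normSqPoly_mul hq), ?_⟩, q, hq, (sub_add_cancel _ _).symm⟩
  rw [map_sub, laplacian_normSqPoly_mul hq, ← hpq, sub_self]

end HarmonicDecomposition

section SphericalHarmonics

variable {ζ : ℕ}

variable (ζ) in
/-- The spherical harmonics of degree `k`, as continuous functions on the sphere. -/
noncomputable def harmonicSpace (k : ℕ) : Submodule ℝ C(Pixel ζ, ℝ) :=
  (solidHarmonics (Fin ζ) ℝ k).map (sphereRestrict ζ).toLinearMap

theorem isSphericalHarmonic_iff_mem_harmonicSpace {k : ℕ} {Y : Pixel ζ → ℝ} :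
    IsSphericalHarmonic k Y ↔ ∃ y ∈ harmonicSpace ζ k, Y = y := by
  simp [isSphericalHarmonic_iff, harmonicSpace]

theorem sphereRestrict_normSqPoly : sphereRestrict ζ (normSqPoly (Fin ζ) ℝ) = 1 := by
  ext x
  simp [sphereRestrict_apply, normSqPoly, sum_sq_eq_one]

theorem sphereRestrict_mem_iSup_of_isHomogeneous (hζ : ζ ≠ 0) {k : ℕ}
    {p : MvPolynomial (Fin ζ) ℝ} (hp : p.IsHomogeneous k) :
    sphereRestrict ζ p ∈ ⨆ j, harmonicSpace ζ j := by
  have : Nonempty (Fin ζ) := ⟨⟨0, Nat.pos_of_ne_zero hζ⟩⟩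
  induction k using Nat.strong_induction_on generalizing p with
  | _ k ih =>
    rcases lt_or_ge k 2 with hk | hk
    · exact Submodule.mem_iSup_of_mem k (Submodule.mem_map_of_mem
        (mem_solidHarmonics.mpr ⟨hp, laplacian_eq_zero_of_lt_two hp hk⟩))
    obtain ⟨h, hh, q, hq, rfl⟩ := exists_eq_solidHarmonic_add_normSqPoly_mul hp
    rw [map_add, map_mul, sphereRestrict_normSqPoly, one_mul]
    exact add_mem (Submodule.mem_iSup_of_mem k (Submodule.mem_map_of_mem hh))
      (ih (k - 2) (by lia) hq)

theorem sphereRestrict_mem_iSup (hζ : ζ ≠ 0) (p : MvPolynomial (Fin ζ) ℝ) :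
    sphereRestrict ζ p ∈ ⨆ j, harmonicSpace ζ j := by
  rw [← sum_homogeneousComponent p, map_sum]
  exact sum_mem fun k _ => sphereRestrict_mem_iSup_of_isHomogeneous hζ
    (homogeneousComponent_isHomogeneous k p)

theorem exists_solidHarmonic_ne_zero {ι : Type*} [Fintype ι] [Nontrivial ι] (k : ℕ) :
    ∃ h ∈ solidHarmonics ι ℝ k, h ≠ 0 := by
  classical
  obtain ⟨i, j, hij⟩ := exists_pair_ne ι
  obtain ⟨h, hh, q, -, hpow⟩ :=
    exists_eq_solidHarmonic_add_normSqPoly_mul (R := ℝ) (isHomogeneous_X_pow i k)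
  refine ⟨h, hh, ?_⟩
  rintro rfl
  -- The complex zero `eᵢ + √-1 eⱼ` of the norm square is not a zero of `Xᵢ ^ k`.
  let v : ι → ℂ := Function.update (Pi.single i 1) j Complex.I
  have hvi : v i = 1 := by simp [v, hij]
  have hvj : v j = Complex.I := by simp [v]
  have hnull : aeval v (normSqPoly ι ℝ) = 0 := by
    simp only [normSqPoly, map_sum, map_pow, aeval_X]
    rw [Fintype.sum_eq_add i j hij fun l hl => by simp [v, hl.1, hl.2], hvi, hvj]
    simp
  simpa [hnull, hvi] using congrArg (aeval v) hpow

theorem sphereRestrict_ne_zero (hζ : ζ ≠ 0) {k : ℕ} {p : MvPolynomial (Fin ζ) ℝ}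
    (hp : p.IsHomogeneous k) (hp0 : p ≠ 0) : sphereRestrict ζ p ≠ 0 := by
  refine fun h => hp0 (funext_set (fun _ => Set.Ioi 0) (fun _ => Set.Ioi_infinite _) fun x hx => ?_)
  let z : EuclideanSpace ℝ (Fin ζ) := WithLp.toLp 2 x
  have hz : ‖z‖ ≠ 0 := norm_ne_zero_iff.mpr fun hz =>
    (hx ⟨0, Nat.pos_of_ne_zero hζ⟩ (Set.mem_univ _)).ne' (congrFun (congrArg WithLp.ofLp hz) _)
  have hω : ‖z‖⁻¹ • z ∈ Metric.sphere (0 : EuclideanSpace ℝ (Fin ζ)) 1 := by simp [norm_smul, hz]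
  have hxz : x = ‖z‖ • (‖z‖⁻¹ • z).ofLp := by rw [WithLp.ofLp_smul, smul_inv_smul₀ hz]
  rw [hxz, eval_smul_of_isHomogeneous hp, ← sphereRestrict_apply p ⟨_, hω⟩, h,
    ContinuousMap.zero_apply, mul_zero, map_zero]

theorem exists_sphericalHarmonic_ne_zero (hζ : 2 ≤ ζ) (k : ℕ) :
    ∃ Y : Pixel ζ → ℝ, IsSphericalHarmonic k Y ∧ ∃ x, Y x ≠ 0 := by
  have : Nontrivial (Fin ζ) := Fin.nontrivial_iff_two_le.mpr hζ
  obtain ⟨h, hh, hne⟩ := exists_solidHarmonic_ne_zero (ι := Fin ζ) k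
  exact ⟨_, isSphericalHarmonic_iff.mpr ⟨h, hh, rfl⟩, DFunLike.ne_iff.mp
    (sphereRestrict_ne_zero (by lia) (mem_solidHarmonics.mp hh).1 hne)⟩

end SphericalHarmonics

/-! ### Continuous functions on compact spaces -/

section CompactSpace

variable {X : Type*} [TopologicalSpace X] [CompactSpace X] [MeasurableSpace X] {μ : Measure X}

theorem integrable_continuous_mul [T2Space X] [BorelSpace X] {f g : X → ℝ} (hg : Continuous g)
    (hf : Integrable f μ) : Integrable (fun x => g x * f x) μ := by
  rw [← integrableOn_univ] at hf ⊢
  exact hf.continuousOn_mul hg.continuousOn isCompact_univ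

theorem integral_mul_integral_comm [T2Space X] [SecondCountableTopology X] [BorelSpace X]
    [SFinite μ] {K : X → X → ℝ} (hK : Continuous fun p : X × X => K p.1 p.2) {f g : X → ℝ}
    (hf : Integrable f μ) (hg : Integrable g μ) :
    ∫ x, g x * ∫ z, K x z * f z ∂μ ∂μ = ∫ z, (∫ x, K x z * g x ∂μ) * f z ∂μ := by
  have hint : Integrable (Function.uncurry fun x z => K x z * (g x * f z)) (μ.prod μ) :=
    integrable_continuous_mul hK (hg.mul_prod hf)
  calc ∫ x, g x * ∫ z, K x z * f z ∂μ ∂μ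
    _ = ∫ x, ∫ z, K x z * (g x * f z) ∂μ ∂μ := by
      simp only [← integral_const_mul, mul_left_comm]
    _ = ∫ z, ∫ x, K x z * (g x * f z) ∂μ ∂μ := integral_integral_swap hint
    _ = ∫ z, (∫ x, K x z * g x ∂μ) * f z ∂μ := by
      simp only [← integral_mul_const, mul_assoc]

theorem ae_eq_zero_of_forall_integral_mul_eq_zero [T2Space X] [BorelSpace X] [IsFiniteMeasure μ]
    [μ.WeaklyRegular] {A : Subalgebra ℝ C(X, ℝ)} (hA : A.SeparatesPoints) {f : X → ℝ}
    (hf : MemLp f 2 μ) (h : ∀ g ∈ A, ∫ x, g x * f x ∂μ = 0) : f =ᵐ[μ] 0 := by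
  have hdense : Dense (A : Set C(X, ℝ)) := by
    rw [dense_iff_closure_eq, ← Subalgebra.topologicalClosure_coe,
      ContinuousMap.subalgebra_topologicalClosure_eq_top_of_separatesPoints A hA]
    rfl
  have hdenseLp := (ContinuousMap.toLp_denseRange (p := 2) ℝ μ ℝ (by simp)).dense_image
    (ContinuousLinearMap.continuous _) hdense
  have hzero : hf.toLp f = 0 := by
    refine hdenseLp.eq_zero_of_inner_left ℝ ?_
    rintro _ ⟨g, hg, rfl⟩
    rw [L2.inner_def, ← h g hg]
    refine integral_congr_ae ?_
    filter_upwards [hf.coeFn_toLp, ContinuousMap.coeFn_toLp (p := 2) (𝕜 := ℝ) μ g] with x hfx hgx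
    rw [hfx, ← hgx]
    rfl
  filter_upwards [hf.coeFn_toLp, Lp.coeFn_zero ℝ 2 μ] with x hfx h0x
  rw [← hfx, hzero, h0x]

end CompactSpace

section ProductFunctions

variable {ι : Type*} [Fintype ι] {X : ι → Type*} [∀ i, TopologicalSpace (X i)]

/-- The continuous function `x ↦ ∏ᵢ fᵢ(xᵢ)` on a product space. It is multiplicative in `f`, which
is what makes the span of these functions a subalgebra. -/
noncomputable def prodFun : (∀ i, C(X i, ℝ)) →* C(∀ i, X i, ℝ) where
  toFun f := ∏ i, (f i).comp (.eval i)
  map_one' := by ext; simp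
  map_mul' f g := by ext; simp [Finset.prod_mul_distrib]

theorem prodFun_apply (f : ∀ i, C(X i, ℝ)) (x : ∀ i, X i) : prodFun f x = ∏ i, f i (x i) := by
  simp [prodFun]

theorem prodFun_mulSingle [DecidableEq ι] (i : ι) (g : C(X i, ℝ)) :
    prodFun (Pi.mulSingle i g) = g.comp (.eval i) := by
  ext x
  rw [prodFun_apply, Fintype.prod_eq_single i fun j hj => by rw [Pi.mulSingle_eq_of_ne hj]; rfl,
    Pi.mulSingle_eq_same]
  rfl

/-- The products `x ↦ ∏ᵢ fᵢ(xᵢ)` with `fᵢ ∈ Aᵢ`. -/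
noncomputable def prodSubmonoid (A : ∀ i, Subalgebra ℝ C(X i, ℝ)) : Submonoid C(∀ i, X i, ℝ) :=
  (Submonoid.pi Set.univ fun i => (A i).toSubmonoid).map prodFun

theorem separatesPoints_adjoin_prodSubmonoid {A : ∀ i, Subalgebra ℝ C(X i, ℝ)}
    (hA : ∀ i, (A i).SeparatesPoints) :
    (Algebra.adjoin ℝ (prodSubmonoid A : Set C(∀ i, X i, ℝ))).SeparatesPoints := by
  classical
  intro x y hxy
  obtain ⟨i, hi⟩ := Function.ne_iff.mp hxy
  obtain ⟨_, ⟨g, hg, rfl⟩, hgxy⟩ := hA i hi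
  have hmem : prodFun (Pi.mulSingle i g) ∈ prodSubmonoid A := by
    refine Submonoid.mem_map_of_mem _ fun j _ => ?_
    rcases eq_or_ne j i with rfl | hj
    · rwa [Pi.mulSingle_eq_same]
    · rw [Pi.mulSingle_eq_of_ne hj]
      exact (A j).one_mem
  exact ⟨_, ⟨_, Algebra.subset_adjoin hmem, rfl⟩, by rwa [prodFun_mulSingle]⟩

theorem ae_eq_zero_of_forall_integral_prodFun_mul_eq_zero [∀ i, CompactSpace (X i)]
    [∀ i, T2Space (X i)] [MeasurableSpace (∀ i, X i)] [BorelSpace (∀ i, X i)]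
    {μ : Measure (∀ i, X i)} [IsFiniteMeasure μ] [μ.WeaklyRegular]
    {A : ∀ i, Subalgebra ℝ C(X i, ℝ)} (hA : ∀ i, (A i).SeparatesPoints) {f : (∀ i, X i) → ℝ}
    (hf : MemLp f 2 μ) (h : ∀ g, (∀ i, g i ∈ A i) → ∫ x, prodFun g x * f x ∂μ = 0) :
    f =ᵐ[μ] 0 := by
  have hint (g : C(∀ i, X i, ℝ)) : Integrable (fun x => g x * f x) μ :=
    integrable_continuous_mul g.continuous (hf.integrable one_le_two)
  refine ae_eq_zero_of_forall_integral_mul_eq_zero (separatesPoints_adjoin_prodSubmonoid hA) hf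
    fun g hg => ?_
  rw [← Subalgebra.mem_toSubmodule, Algebra.adjoin_eq_span, Submonoid.closure_eq] at hg
  induction hg using Submodule.span_induction with
  | mem g hg =>
    obtain ⟨y, hy, rfl⟩ := hg
    exact h y fun i => hy i (Set.mem_univ i)
  | zero => simp
  | add g g' _ _ hg hg' =>
    simp only [ContinuousMap.add_apply, add_mul]
    rw [integral_add (hint g) (hint g'), hg, hg', add_zero]
  | smul c g _ hg =>
    simp only [ContinuousMap.smul_apply, smul_eq_mul, mul_assoc]
    rw [integral_const_mul, hg, mul_zero]

end ProductFunctions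

/-! ### The multisphere -/

section Multisphere

instance instIsFiniteMeasureSurfaceMeasure (m : ℕ) : IsFiniteMeasure (surfaceMeasure m) :=
  inferInstanceAs (IsFiniteMeasure (Measure.toSphere _))

instance instIsOpenPosMeasureSurfaceMeasure (m : ℕ) : (surfaceMeasure m).IsOpenPosMeasure :=
  inferInstanceAs (Measure.toSphere _).IsOpenPosMeasure

instance instIsFiniteMeasureMultiMeasure (ζ d : ℕ) : IsFiniteMeasure (multiMeasure ζ d) :=
  inferInstanceAs (IsFiniteMeasure (Measure.pi _))

instance instIsOpenPosMeasureMultiMeasure (ζ d : ℕ) : (multiMeasure ζ d).IsOpenPosMeasure :=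
  Measure.pi.isOpenPosMeasure _

variable {ζ d : ℕ}

theorem pixelDots_comm (x z : Multisphere ζ d) : pixelDots x z = pixelDots z x :=
  funext fun _ => real_inner_comm _ _

theorem pixelDots_mem_Icc (x z : Multisphere ζ d) (i : Fin d) :
    pixelDots x z i ∈ Set.Icc (-1 : ℝ) 1 :=
  real_inner_mem_Icc_of_norm_eq_one (norm_eq_of_mem_sphere _) (norm_eq_of_mem_sphere _)

theorem continuous_prod_pixelDots_pow (n : Fin d → ℕ) :
    Continuous fun p : Multisphere ζ d × Multisphere ζ d => ∏ i, pixelDots p.1 p.2 i ^ n i := by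
  unfold pixelDots
  fun_prop

theorem isSHProduct_iff {k : Fin d → ℕ} {Y : Multisphere ζ d → ℝ} :
    IsSHProduct k Y ↔
      ∃ y : Fin d → C(Pixel ζ, ℝ), (∀ i, y i ∈ harmonicSpace ζ (k i)) ∧ Y = prodFun y := by
  simp only [IsSHProduct, isSphericalHarmonic_iff_mem_harmonicSpace, funext_iff, prodFun_apply]
  constructor
  · rintro ⟨y, hy, hY⟩
    choose y' hy' hyy' using hy
    exact ⟨y', hy', by simpa only [hyy'] using hY⟩
  · rintro ⟨y, hy, hY⟩
    exact ⟨fun i => y i, fun i => ⟨y i, hy i, fun _ => rfl⟩, hY⟩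

theorem IsSHProduct.continuous {k : Fin d → ℕ} {Y : Multisphere ζ d → ℝ}
    (hY : IsSHProduct k Y) : Continuous Y := by
  obtain ⟨y, -, rfl⟩ := isSHProduct_iff.mp hY
  exact (prodFun y).continuous

theorem exists_isSHProduct_ne_zero (hζ : 2 ≤ ζ) (k : Fin d → ℕ) :
    ∃ Y : Multisphere ζ d → ℝ, IsSHProduct k Y ∧ ∃ x, Y x ≠ 0 := by
  choose y hy x hx using fun i => exists_sphericalHarmonic_ne_zero hζ (k i)
  exact ⟨fun z => ∏ i, y i (z i), ⟨y, hy, fun _ => rfl⟩, x,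
    Finset.prod_ne_zero_iff.mpr fun i _ => hx i⟩

theorem integral_prod_pixelDots_pow_mul (hζ : 2 ≤ ζ) {k : Fin d → ℕ} {Y : Multisphere ζ d → ℝ}
    (hY : IsSHProduct k Y) (n : Fin d → ℕ) (x : Multisphere ζ d) :
    ∫ z, (∏ i, pixelDots x z i ^ n i) * Y z ∂multiMeasure ζ d =
      sphereArea (ζ - 1) ^ d * (∏ i, monomialEigenvalue ζ (k i) (n i)) * Y x := by
  obtain ⟨y, hy, hYy⟩ := hY
  simp only [hYy, ← Finset.prod_mul_distrib, pixelDots, multiMeasure]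
  rw [integral_fintype_prod_eq_prod (f := fun i (w : Pixel ζ) =>
    inner ℝ (x i : EuclideanSpace ℝ (Fin ζ)) (w : EuclideanSpace ℝ (Fin ζ)) ^ n i * y i w)]
  simp only [integral_inner_pow_mul_sphericalHarmonic hζ (hy _), Finset.prod_mul_distrib,
    Finset.prod_const, Finset.card_univ, Fintype.card_fin]

theorem separatesPoints_range_sphereRestrict : (sphereRestrict ζ).range.SeparatesPoints := by
  intro x y hxy
  obtain ⟨i, hi⟩ : ∃ i, (x : EuclideanSpace ℝ (Fin ζ)) i ≠ (y : EuclideanSpace ℝ (Fin ζ)) i := by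
    by_contra! h
    exact hxy (Subtype.ext (PiLp.ext h))
  exact ⟨_, ⟨sphereRestrict ζ (X i), ⟨X i, rfl⟩, rfl⟩, by simpa [sphereRestrict_apply] using hi⟩

theorem integral_prodFun_mul_eq_zero {f : Multisphere ζ d → ℝ}
    (hf : Integrable f (multiMeasure ζ d))
    (h : ∀ (k : Fin d → ℕ) (Y : Multisphere ζ d → ℝ), IsSHProduct k Y →
      ∫ z, Y z * f z ∂multiMeasure ζ d = 0)
    {y : Fin d → C(Pixel ζ, ℝ)} (hy : ∀ i, y i ∈ ⨆ j, harmonicSpace ζ j) :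
    ∫ z, prodFun y z * f z ∂multiMeasure ζ d = 0 := by
  choose F hF hFy using fun i => (Submodule.mem_iSup_iff_exists_finsupp _ _).mp (hy i)
  have hSH (k : Fin d → ℕ) : IsSHProduct k (prodFun fun i => F i (k i) : C(Multisphere ζ d, ℝ)) :=
    isSHProduct_iff.mpr ⟨_, fun i => hF i (k i), rfl⟩
  have hexpand (z : Multisphere ζ d) : prodFun y z =
      ∑ k ∈ Fintype.piFinset fun i => (F i).support, prodFun (fun i => F i (k i)) z := by
    simp only [prodFun_apply, ← hFy, Finsupp.sum, ContinuousMap.sum_apply,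
      ← Finset.prod_univ_sum (fun i => (F i).support) fun i j => F i j (z i)]
  simp only [hexpand, Finset.sum_mul]
  rw [integral_finsetSum _ fun k _ => integrable_continuous_mul (hSH k).continuous hf]
  exact Finset.sum_eq_zero fun k _ => h k _ (hSH k)

theorem ae_eq_zero_of_forall_integral_isSHProduct_mul_eq_zero (hζ : ζ ≠ 0)
    {f : Multisphere ζ d → ℝ} (hf : MemLp f 2 (multiMeasure ζ d))
    (h : ∀ (k : Fin d → ℕ) (Y : Multisphere ζ d → ℝ), IsSHProduct k Y →
      ∫ z, Y z * f z ∂multiMeasure ζ d = 0) : f =ᵐ[multiMeasure ζ d] 0 := by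
  refine ae_eq_zero_of_forall_integral_prodFun_mul_eq_zero
    (fun _ => separatesPoints_range_sphereRestrict) hf fun g hg => ?_
  refine integral_prodFun_mul_eq_zero (hf.integrable one_le_two) h fun i => ?_
  obtain ⟨p, hp⟩ := hg i
  exact hp ▸ sphereRestrict_mem_iSup hζ p

end Multisphere

/-! ### The eigenvalues of a multi-dot product kernel -/

section Eigenvalues

variable {d : ℕ} {κ : (Fin d → ℝ) → ℝ} {b : (Fin d → ℕ) → ℝ}

theorem HasPowerSeriesOnCube.summable_abs (hκ : HasPowerSeriesOnCube κ b) :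
    Summable fun n => |b n| := by
  simpa using (hκ (fun _ => 1) fun _ => by simp).summable.abs

theorem abs_mul_prod_pow_le (c : ℝ) (n : Fin d → ℕ) {t : Fin d → ℝ}
    (ht : ∀ i, t i ∈ Set.Icc (-1 : ℝ) 1) : |c * ∏ i, t i ^ n i| ≤ |c| := by
  rw [abs_mul, Finset.abs_prod]
  refine mul_le_of_le_one_right (abs_nonneg c) (Finset.prod_le_one (fun _ _ => abs_nonneg _) ?_)
  intro i _
  rw [abs_pow]
  exact pow_le_one₀ (abs_nonneg _) (abs_le.mpr (ht i))

theorem injective_add_two_mul (k : Fin d → ℕ) :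
    Function.Injective fun s : Fin d → ℕ => fun i => k i + 2 * s i := by
  intro s s' h
  ext i
  simpa using congrFun h i

variable {ζ : ℕ} {K : Multisphere ζ d → Multisphere ζ d → ℝ}

theorem IsMultiDotProduct.symm (hK : IsMultiDotProduct K κ) (x z : Multisphere ζ d) :
    K x z = K z x := by
  rw [hK, hK, pixelDots_comm]

theorem IsMultiDotProduct.continuous (hK : IsMultiDotProduct K κ)
    (hκ : HasPowerSeriesOnCube κ b) :
    Continuous fun p : Multisphere ζ d × Multisphere ζ d => K p.1 p.2 := by
  simp only [hK _ _, ← (hκ _ (pixelDots_mem_Icc _ _)).tsum_eq]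
  exact continuous_tsum (fun n => continuous_const.mul (continuous_prod_pixelDots_pow n))
    hκ.summable_abs fun n p => abs_mul_prod_pow_le _ _ (pixelDots_mem_Icc p.1 p.2)

theorem hasSum_kernelOp (hK : IsMultiDotProduct K κ) (hκ : HasPowerSeriesOnCube κ b)
    {f : Multisphere ζ d → ℝ} (hf : Integrable f (multiMeasure ζ d)) (x : Multisphere ζ d) :
    HasSum (fun n => b n * ∫ z, (∏ i, pixelDots x z i ^ n i) * f z ∂multiMeasure ζ d)
      (kernelOp K f x) := by
  have hcont (n : Fin d → ℕ) : Continuous fun z => ∏ i, pixelDots x z i ^ n i := by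
    unfold pixelDots
    fun_prop
  have hint (n : Fin d → ℕ) :
      Integrable (fun z => (b n * ∏ i, pixelDots x z i ^ n i) * f z) (multiMeasure ζ d) :=
    integrable_continuous_mul (continuous_const.mul (hcont n)) hf
  have hbound (n : Fin d → ℕ) :
      ∫ z, ‖(b n * ∏ i, pixelDots x z i ^ n i) * f z‖ ∂multiMeasure ζ d ≤
        |b n| * ∫ z, ‖f z‖ ∂multiMeasure ζ d := by
    rw [← integral_const_mul]
    refine integral_mono (hint n).norm (hf.norm.const_mul _) fun z => ?_
    rw [norm_mul]
    exact mul_le_mul_of_nonneg_right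
      (abs_mul_prod_pow_le _ _ (pixelDots_mem_Icc x z)) (norm_nonneg _)
  have hsummable := Summable.of_nonneg_of_le
    (fun n => integral_nonneg fun _ => norm_nonneg _) hbound (hκ.summable_abs.mul_right _)
  have hseries (z : Multisphere ζ d) :
      ∑' n, (b n * ∏ i, pixelDots x z i ^ n i) * f z = K x z * f z := by
    rw [hK, ((hκ _ (pixelDots_mem_Icc x z)).mul_right (f z)).tsum_eq]
  have h := hasSum_integral_of_summable_integral_norm hint hsummable
  simp only [hseries] at h
  simp only [mul_assoc, integral_const_mul] at h
  exact h

theorem prod_monomialEigenvalue_eq_zero (hζ : 2 ≤ ζ) {k n : Fin d → ℕ}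
    (hn : n ∉ Set.range fun s : Fin d → ℕ => fun i => k i + 2 * s i) :
    ∏ i, monomialEigenvalue ζ (k i) (n i) = 0 := by
  contrapose! hn
  have hparity (i : Fin d) : ∃ s, k i + 2 * s = n i := by
    by_contra! hi
    refine hn (Finset.prod_eq_zero (Finset.mem_univ i) (monomialEigenvalue_eq_zero hζ ?_))
    rintro ⟨hle, s, hs⟩
    exact hi s (by omega)
  choose s hs using hparity
  exact ⟨s, funext hs⟩

theorem hasSum_eigenTerm_mul (hζ : 2 ≤ ζ) (hK : IsMultiDotProduct K κ)
    (hκ : HasPowerSeriesOnCube κ b) {k : Fin d → ℕ} {Y : Multisphere ζ d → ℝ}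
    (hY : IsSHProduct k Y) (x : Multisphere ζ d) :
    HasSum (fun s => sphereArea (ζ - 1) ^ d * eigenTerm ζ b k s * Y x) (kernelOp K Y x) := by
  have hYint : Integrable Y (multiMeasure ζ d) :=
    hY.continuous.integrable_of_hasCompactSupport (.of_compactSpace Y)
  have h := hasSum_kernelOp hK hκ hYint x
  simp only [integral_prod_pixelDots_pow_mul hζ hY] at h
  rw [← (injective_add_two_mul k).hasSum_iff fun n hn => by
    simp [prod_monomialEigenvalue_eq_zero hζ hn]] at h
  refine h.congr_fun fun s => ?_
  simp only [Function.comp_apply, eigenTerm]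
  ring

theorem summable_eigenTerm (hζ : 2 ≤ ζ) (hκ : HasPowerSeriesOnCube κ b) (k : Fin d → ℕ) :
    Summable (eigenTerm ζ b k) := by
  obtain ⟨Y, hY, x, hx⟩ := exists_isSHProduct_ne_zero hζ k
  have hK : IsMultiDotProduct (fun x z : Multisphere ζ d => κ (pixelDots x z)) κ := fun _ _ => rfl
  have h := (hasSum_eigenTerm_mul hζ hK hκ hY x).summable
  have harea : sphereArea (ζ - 1) ^ d ≠ 0 := pow_ne_zero _ (sphereArea_pos (by omega)).ne'
  rwa [summable_mul_right_iff hx, summable_mul_left_iff harea] at h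

theorem kernelOp_eq_seriesEigenvalue_mul (hζ : 2 ≤ ζ) (hK : IsMultiDotProduct K κ)
    (hκ : HasPowerSeriesOnCube κ b) {k : Fin d → ℕ} {Y : Multisphere ζ d → ℝ}
    (hY : IsSHProduct k Y) (x : Multisphere ζ d) :
    kernelOp K Y x = seriesEigenvalue ζ b k * Y x :=
  (hasSum_eigenTerm_mul hζ hK hκ hY x).unique
    (((summable_eigenTerm hζ hκ k).hasSum.mul_left _).mul_right _)

theorem isEigenvalueAt_iff (hζ : 2 ≤ ζ) (hK : IsMultiDotProduct K κ)
    (hκ : HasPowerSeriesOnCube κ b) (k : Fin d → ℕ) (μ : ℝ) :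
    IsEigenvalueAt K k μ ↔ μ = seriesEigenvalue ζ b k := by
  constructor
  · intro h
    obtain ⟨Y, hY, x, hx⟩ := exists_isSHProduct_ne_zero hζ k
    exact mul_right_cancel₀ hx
      ((h Y hY x).symm.trans (kernelOp_eq_seriesEigenvalue_mul hζ hK hκ hY x))
  · rintro rfl Y hY x
    exact kernelOp_eq_seriesEigenvalue_mul hζ hK hκ hY x

theorem eq_seriesEigenvalue_of_integral_mul_ne_zero (hζ : 2 ≤ ζ) (hK : IsMultiDotProduct K κ)
    (hκ : HasPowerSeriesOnCube κ b) {μ : ℝ} {f : Multisphere ζ d → ℝ}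
    (hf : Integrable f (multiMeasure ζ d))
    (hfμ : ∀ᵐ x ∂multiMeasure ζ d, kernelOp K f x = μ * f x) {k : Fin d → ℕ}
    {Y : Multisphere ζ d → ℝ} (hY : IsSHProduct k Y)
    (hne : ∫ z, Y z * f z ∂multiMeasure ζ d ≠ 0) : μ = seriesEigenvalue ζ b k := by
  have hYint : Integrable Y (multiMeasure ζ d) :=
    hY.continuous.integrable_of_hasCompactSupport (.of_compactSpace Y)
  have hadjoint (z : Multisphere ζ d) :
      ∫ x, K x z * Y x ∂multiMeasure ζ d = seriesEigenvalue ζ b k * Y z := by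
    simp only [hK.symm _ z]
    exact kernelOp_eq_seriesEigenvalue_mul hζ hK hκ hY z
  refine mul_right_cancel₀ hne ?_
  calc μ * ∫ z, Y z * f z ∂multiMeasure ζ d
    _ = ∫ x, Y x * kernelOp K f x ∂multiMeasure ζ d := by
      rw [← integral_const_mul]
      refine integral_congr_ae ?_
      filter_upwards [hfμ] with x hx
      rw [hx, mul_left_comm]
    _ = ∫ z, (∫ x, K x z * Y x ∂multiMeasure ζ d) * f z ∂multiMeasure ζ d :=
      integral_mul_integral_comm (hK.continuous hκ) hf hYint
    _ = seriesEigenvalue ζ b k * ∫ z, Y z * f z ∂multiMeasure ζ d := by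
      simp only [hadjoint, mul_assoc, integral_const_mul]

theorem isKernelEigenvalue_iff (hζ : 2 ≤ ζ) (hK : IsMultiDotProduct K κ)
    (hκ : HasPowerSeriesOnCube κ b) (μ : ℝ) :
    IsKernelEigenvalue K μ ↔ ∃ k : Fin d → ℕ, μ = seriesEigenvalue ζ b k := by
  constructor
  · rintro ⟨f, hf, hf0, hfμ⟩
    obtain ⟨k, Y, hY, hne⟩ : ∃ (k : Fin d → ℕ) (Y : Multisphere ζ d → ℝ),
        IsSHProduct k Y ∧ ∫ z, Y z * f z ∂multiMeasure ζ d ≠ 0 := by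
      by_contra! h
      exact hf0 (ae_eq_zero_of_forall_integral_isSHProduct_mul_eq_zero (by omega) hf h)
    exact ⟨k, eq_seriesEigenvalue_of_integral_mul_ne_zero hζ hK hκ
      (hf.integrable one_le_two) hfμ hY hne⟩
  · rintro ⟨k, rfl⟩
    obtain ⟨Y, hY, x, hx⟩ := exists_isSHProduct_ne_zero hζ k
    refine ⟨Y, hY.continuous.memLp_of_hasCompactSupport (.of_compactSpace Y), fun hY0 => hx ?_,
      .of_forall (kernelOp_eq_seriesEigenvalue_mul hζ hK hκ hY)⟩
    exact congrFun ((hY.continuous.ae_eq_iff_eq _ continuous_zero).mp hY0) x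

end Eigenvalues

end MultiDot

theorem mainTheorem6 (ζ d : ℕ) (hζ : 2 ≤ ζ)
    (K : MultiDot.Multisphere ζ d → MultiDot.Multisphere ζ d → ℝ)
    (κ : (Fin d → ℝ) → ℝ) (b : (Fin d → ℕ) → ℝ)
    (hK : MultiDot.IsMultiDotProduct K κ) (hκ : MultiDot.HasPowerSeriesOnCube κ b) :
    (∀ k n : ℕ, MultiDot.monomialEigenvalue ζ k n =
      if k ≤ n ∧ Even (n - k) then
        (n.factorial : ℝ) / (((n - k).factorial : ℝ) * 2 ^ k) *
          (Real.Gamma (((ζ : ℝ) - 1) / 2) * Real.Gamma (((n : ℝ) - k + 1) / 2) /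
            Real.Gamma (((n : ℝ) + k + ζ) / 2))
      else 0) ∧
    (∀ k : Fin d → ℕ, Summable (MultiDot.eigenTerm ζ b k) ∧
      ∀ μ : ℝ, MultiDot.IsEigenvalueAt K k μ ↔ μ = MultiDot.seriesEigenvalue ζ b k) ∧
    (∀ μ : ℝ, MultiDot.IsKernelEigenvalue K μ ↔
      ∃ k : Fin d → ℕ, μ = MultiDot.seriesEigenvalue ζ b k) :=
  ⟨MultiDot.monomialEigenvalue_eq_ite hζ,
    fun k => ⟨MultiDot.summable_eigenTerm hζ hκ k, MultiDot.isEigenvalueAt_iff hζ hK hκ k⟩,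
    MultiDot.isKernelEigenvalue_iff hζ hK hκ⟩
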